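/- **Setting.** Let $\mathbb S^2\subset\mathbb R^3$ be the unit sphere with its surface measure, let $\Delta$ be its Laplace–Beltrami operator, fix a real number $k>1$ and put $A=-\Delta+k$ (eigenvalue $l(l+1)+k$ on the spherical harmonics of degree $l$). Let $\mathcal E=C^\infty(\mathbb S^2)$ be the space of smooth real functions with the topology of the norms $\|\alpha\|_p=\|A^p\alpha\|_{L^2(\mathbb S^2)}$, $p\in\mathbb N=\{0,1,2,\dots\}$. Let $\mathcal E'$ be its topological dual, with pairing $(\beta,\alpha)$ and the $\sigma$-algebra generated by the maps $\beta\mapsto(\beta,\alpha)$. Let $\nu$ be the standard Gaussian (white noise) measure on $\mathcal E'$, i.e. the probability measure with $$\int_{\mathcal E'}e^{i(\beta,\alpha)}\,d\nu(\beta)=e^{-\frac12\|\alpha\|_{L^2(\mathbb S^2)}^2}\qquad(\alpha\in\mathcal E).$$ Let $(L^2)=L^2(\mathcal E',\nu;\mathbb R)$. For $\alpha\in\mathcal E$ let $$I_n(\alpha^{\otimes n})(\beta)=\sum_{j=0}^{\lfloor n/2\rfloor}\binom n{2j}(2j-1)!!\,\bigl(-\|\alpha\|_{L^2(\mathbb S^2)}^2\bigr)^j(\beta,\alpha)^{n-2j}$$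 be the multiple Wiener integral of $\alpha^{\otimes n}$. Let $\Gamma(A)$ be the closed operator on $(L^2)$ whose graph is the closed linear span of the pairs $\bigl(I_n(\alpha^{\otimes n}),I_n((A\alpha)^{\otimes n})\bigr)$, $n\in\mathbb N$, $\alpha\in\mathcal E$. Let $(\mathcal E)=\bigcap_{p\in\mathbb N}D(\Gamma(A)^p)$ be the space of Hida test functionals, with the projective limit topology given by the norms $\|\psi\|_p=\|\Gamma(A)^p\psi\|_{(L^2)}$, $p\in\mathbb N$. Let $(\mathcal E')$, the space of Hida distributions, be the topological dual of $(\mathcal E)$ with the strong topology. Let $\Gamma$ be the phase space, either $(L^2)\times(L^2)$ or $(\mathcal E)\times(\mathcal E')$, with the product topology, and let $$\Omega:\Gamma\times\Gamma\to\mathbb R,\qquad \Omega\bigl((\psi_1,\Psi_1),(\psi_2,\Psi_2)\bigr)=\langle\langle\Psi_2,\psi_1\rangle\rangle-\langle\langle\Psi_1,\psi_2\rangle\rangle ,$$ where $\langle\langle\cdot,\cdot\rangle\rangle$ is the inner product of $(L^2)$ in the first case and the canonical pairing of $(\mathcal E')$ with $(\mathcal E)$ in the second. **Proposition.** In both cases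 $(\Gamma,\Omega)$ is a weakly non-degenerate symplectic vector space: $\Omega$ is bilinear and skew-symmetric; it is sequentially continuous on $\Gamma\times\Gamma$; $\Omega^\flat:v\mapsto\Omega(v,\cdot)$ is a continuous linear map from $\Gamma$ into its topological dual $\Gamma^*$ with the strong topology; and $\Omega(v,w)=0$ for all $w\in\Gamma$ implies $v=0$. In the Hilbert case $\Gamma=(L^2)\times(L^2)$, moreover, $\Omega$ is jointly continuous on $\Gamma\times\Gamma$ and strongly non-degenerate: $\Omega^\flat:\Gamma\to\Gamma^*$ is a topological isomorphism. -/

import Mathlib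

open scoped Manifold ContDiff Topology
open MeasureTheory InnerProductSpace

noncomputable section

namespace HidaPhaseSpace

/-! ### The unit sphere and its Laplace-Beltrami operator -/

/-- Euclidean three-space. -/
abbrev E3 : Type := EuclideanSpace ℝ (Fin 3)

/-- The unit two-sphere. -/
abbrev S2 : Type := Metric.sphere (0 : E3) 1

/-- The canonical surface measure on the unit sphere (of total mass `4π`). -/
def surfaceMeasure : Measure S2 := (volume : Measure E3).toSphere

instance : IsFiniteMeasure surfaceMeasure :=
  inferInstanceAs (IsFiniteMeasure (volume : Measure E3).toSphere)

/-- Smooth real functions on the sphere. -/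
abbrev SmoothS2 : Type := C^∞⟮𝓡 2, S2; 𝓘(ℝ, ℝ), ℝ⟯

/-- The extension of a function on the sphere to three-space which is constant along rays
(with value `0` at the origin). -/
def radialExt (f : S2 → ℝ) (y : E3) : ℝ :=
  if h : y = 0 then 0 else f ⟨‖y‖⁻¹ • y, by simp [norm_smul, h]⟩

lemma finrank_E3 : Fact (Module.finrank ℝ E3 = 2 + 1) := ⟨by simp⟩

lemma radialExt_contDiffAt (f : SmoothS2) {y : E3} (hy : y ≠ 0) :
    ContDiffAt ℝ ∞ (radialExt f) y := by
  let U : TopologicalSpace.Opens E3 := ⟨{0}ᶜ, isOpen_compl_singleton⟩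
  have hU : ∀ u : U, (u : E3) ≠ 0 := fun u => u.2
  let g : U → E3 := fun u => ‖(u : E3)‖⁻¹ • (u : E3)
  have hg : ContMDiff 𝓘(ℝ, E3) 𝓘(ℝ, E3) ∞ g := by
    intro u
    have h1 : ContDiffAt ℝ ∞ (fun z : E3 => ‖z‖⁻¹ • z) (u : E3) :=
      ((contDiffAt_norm ℝ (hU u)).inv (by simpa using hU u)).smul contDiffAt_id
    exact (h1.contMDiffAt).comp u contMDiff_subtype_val.contMDiffAt
  have hg' : ∀ u, g u ∈ Metric.sphere (0 : E3) 1 := by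
    intro u
    have := hU u
    simp [g, norm_smul, this]
  have := finrank_E3
  have h2 : ContMDiff 𝓘(ℝ, E3) (𝓡 2) ∞ (Set.codRestrict g _ hg') :=
    hg.codRestrict_sphere hg'
  have h3 : ContMDiff 𝓘(ℝ, E3) 𝓘(ℝ, ℝ) ∞ (fun u : U => radialExt f (u : E3)) := by
    have h4 := f.contMDiff.comp h2
    convert h4 using 1
    funext u
    simp [radialExt, hU u, g, Set.codRestrict]
  have h5 := h3 ⟨y, hy⟩
  exact (contMDiffAt_subtype_iff (U := U) (x := ⟨y, hy⟩) (f := radialExt f)).1 h5 |>.contDiffAt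

lemma contDiffAt_laplacian {F : E3 → ℝ} {y : E3} (h : ContDiffAt ℝ ∞ F y) :
    ContDiffAt ℝ ∞ (Laplacian.laplacian F) y := by
  rw [laplacian_eq_iteratedFDeriv_stdOrthonormalBasis]
  refine ContDiffAt.sum fun i _ => ?_
  have h1 : ContDiffAt ℝ ∞ (iteratedFDeriv ℝ 2 F) y := h.iteratedFDeriv_right le_rfl
  exact (ContinuousMultilinearMap.apply ℝ (fun _ : Fin 2 => E3) ℝ _).contDiff.contDiffAt.comp y h1

lemma sphere_ne_zero (x : S2) : (x : E3) ≠ 0 := by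
  intro h
  have := x.2
  simp [h] at this

/-- The Laplace-Beltrami operator of the round unit sphere: the Euclidean Laplacian of the
extension constant along rays, restricted to the sphere. -/
def laplaceBeltrami : SmoothS2 →ₗ[ℝ] SmoothS2 where
  toFun f := ⟨fun x => Laplacian.laplacian (radialExt f) (x : E3), fun x =>
    (contDiffAt_laplacian (radialExt_contDiffAt f (sphere_ne_zero x))).contMDiffAt.comp x
      (by have := finrank_E3; exact contMDiff_coe_sphere x)⟩
  map_add' f g := by
    ext x
    have h : radialExt (⇑(f + g)) = radialExt f + radialExt g := by
      funext y
      by_cases hy : y = 0 <;> simp [radialExt, hy]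
    have hf := (radialExt_contDiffAt f (sphere_ne_zero x)).of_le (m := 2) (by norm_cast)
    have hg := (radialExt_contDiffAt g (sphere_ne_zero x)).of_le (m := 2) (by norm_cast)
    change Laplacian.laplacian (radialExt (⇑(f + g))) (x : E3) = _
    rw [h]
    exact hf.laplacian_add hg
  map_smul' c f := by
    ext x
    have h : radialExt (⇑(c • f)) = c • radialExt f := by
      funext y
      by_cases hy : y = 0 <;> simp [radialExt, hy]
    have hf := (radialExt_contDiffAt f (sphere_ne_zero x)).of_le (m := 2) (by norm_cast)
    change Laplacian.laplacian (radialExt (⇑(c • f))) (x : E3) = _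
    rw [h]
    exact laplacian_smul c hf

/-- The operator `A = -Δ + k` on smooth functions, with eigenvalue `l (l + 1) + k` on the
spherical harmonics of degree `l`. -/
def opA (k : ℝ) : Module.End ℝ SmoothS2 := -laplaceBeltrami + k • LinearMap.id

/-- The embedding of smooth functions into `L²(S²)`. -/
def toL2 : SmoothS2 →ₗ[ℝ] Lp ℝ 2 surfaceMeasure :=
  (ContinuousMap.toLp (E := ℝ) 2 surfaceMeasure ℝ).toLinearMap ∘ₗ
    { toFun := fun f => (⟨f, f.contMDiff.continuous⟩ : C(S2, ℝ))
      map_add' := fun _ _ => rfl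
      map_smul' := fun _ _ => rfl }

/-! ### The nuclear space `𝓔 = C^∞(S²)`, its dual, and the white noise measure -/

/-- The space `𝓔`: smooth functions on the sphere, with the topology of the norms
`‖α‖_p = ‖A^p α‖` in `L²(S²)`, for all natural numbers `p`. -/
def TestS2 (_k : ℝ) : Type := SmoothS2

instance (k : ℝ) : AddCommGroup (TestS2 k) := inferInstanceAs (AddCommGroup SmoothS2)
instance (k : ℝ) : Module ℝ (TestS2 k) := inferInstanceAs (Module ℝ SmoothS2)

/-- The operator `A` on `𝓔`. -/
def TestS2.A (k : ℝ) : Module.End ℝ (TestS2 k) := opA k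

/-- The inclusion of `𝓔` into `L²(S²)`. -/
def TestS2.incl (k : ℝ) : TestS2 k →ₗ[ℝ] Lp ℝ 2 surfaceMeasure := toL2

/-- The norms `‖α‖_p = ‖A^p α‖` on `𝓔`. -/
def TestS2.seminorms (k : ℝ) : SeminormFamily ℝ (TestS2 k) ℕ := fun p =>
  (normSeminorm ℝ (Lp ℝ 2 surfaceMeasure)).comp (TestS2.incl k ∘ₗ (TestS2.A k) ^ p)

instance (k : ℝ) : TopologicalSpace (TestS2 k) := (TestS2.seminorms k).moduleFilterBasis.topology

lemma TestS2.withSeminorms (k : ℝ) : WithSeminorms (TestS2.seminorms k) := ⟨rfl⟩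

instance (k : ℝ) : IsTopologicalAddGroup (TestS2 k) :=
  (TestS2.withSeminorms k).topologicalAddGroup

instance (k : ℝ) : ContinuousSMul ℝ (TestS2 k) := (TestS2.withSeminorms k).continuousSMul

/-- The space `𝓔'` of real distributions on the sphere. -/
abbrev DistS2 (k : ℝ) : Type := StrongDual ℝ (TestS2 k)

/-- The `σ`-algebra on `𝓔'` generated by the evaluations `β ↦ (β, α)`. -/
instance (k : ℝ) : MeasurableSpace (DistS2 k) :=
  ⨆ α : TestS2 k, MeasurableSpace.comap (fun β : DistS2 k => β α) (borel ℝ)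

/-- `ν` is the standard Gaussian (white noise) measure on `𝓔'`: the probability measure with
characteristic function `α ↦ exp (-‖α‖² / 2)`, the norm being that of `L²(S²)`. -/
structure IsWhiteNoise {k : ℝ} (ν : Measure (DistS2 k)) : Prop where
  isProbabilityMeasure : IsProbabilityMeasure ν
  charFun_eq : ∀ α : TestS2 k,
    ∫ β, Complex.exp (Complex.I * ((β α : ℝ) : ℂ)) ∂ν =
      Complex.exp (-((‖TestS2.incl k α‖ ^ 2 / 2 : ℝ) : ℂ))

/-! ### Second quantization and the Hida spaces -/

/-- The space `(L²)` of real square integrable functions on `(𝓔', ν)`. -/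
abbrev L2 {k : ℝ} (ν : Measure (DistS2 k)) : Type := Lp ℝ 2 ν

/-- The multiple Wiener integral `I_n(α^{⊗n})`, that is, the pairing of the Wick power
`:β^{⊗n}:` with `α^{⊗n}`:
`∑_{j ≤ n/2} C(n, 2j) (2j - 1)!! (-‖α‖²)^j (β, α)^(n - 2j)`. -/
def wickPower {k : ℝ} (n : ℕ) (α : TestS2 k) (β : DistS2 k) : ℝ :=
  ∑ j ∈ Finset.range (n / 2 + 1),
    (n.choose (2 * j) : ℝ) * (Nat.doubleFactorial (2 * j - 1) : ℝ) *
      (-‖TestS2.incl k α‖ ^ 2) ^ j * (β α) ^ (n - 2 * j)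

/-- The pairs `(I_n(α^{⊗n}), I_n((Aα)^{⊗n}))` in `(L²) × (L²)`. -/
def secondQuantCore {k : ℝ} (ν : Measure (DistS2 k)) : Set (L2 ν × L2 ν) :=
  {z | ∃ (n : ℕ) (α : TestS2 k),
    z.1 =ᵐ[ν] wickPower n α ∧ z.2 =ᵐ[ν] wickPower n (TestS2.A k α)}

/-- The second quantization `Γ(A)`: the closed operator on `(L²)` whose graph is the closed span
of the pairs `(I_n(α^{⊗n}), I_n((Aα)^{⊗n}))`. -/
def secondQuant {k : ℝ} (ν : Measure (DistS2 k)) : L2 ν →ₗ.[ℝ] L2 ν :=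
  (Submodule.span ℝ (secondQuantCore ν)).topologicalClosure.toLinearPMap

/-- The composition `S ∘ T` of unbounded operators, with domain `{x ∈ D(T) | T x ∈ D(S)}`. -/
def pmapComp {H : Type*} [AddCommGroup H] [Module ℝ H] (S T : H →ₗ.[ℝ] H) : H →ₗ.[ℝ] H where
  domain := (S.domain.comap T.toFun).map T.domain.subtype
  toFun := S.toFun ∘ₗ
    (T.toFun.comp (Submodule.inclusion (by
      rintro _ ⟨x, -, rfl⟩
      exact x.2))).codRestrict S.domain (by
        rintro ⟨_, x, hx, rfl⟩
        exact hx)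

/-- The powers of an unbounded operator, with `T^0` the identity on the whole space. -/
def pmapPow {H : Type*} [AddCommGroup H] [Module ℝ H] (T : H →ₗ.[ℝ] H) : ℕ → (H →ₗ.[ℝ] H)
  | 0 => (LinearMap.id : H →ₗ[ℝ] H).toPMap ⊤
  | p + 1 => pmapComp T (pmapPow T p)

/-- The subspace `⋂_p (𝓔)_p` of `(L²)`, where `(𝓔)_p` is the domain of `Γ(A)^p`. -/
def hidaSubmodule {k : ℝ} (ν : Measure (DistS2 k)) : Submodule ℝ (L2 ν) :=
  ⨅ p : ℕ, (pmapPow (secondQuant ν) p).domain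

/-- The space `(𝓔)` of Hida test functionals; its topology, defined below, is the projective
limit topology and not the one induced by `(L²)`. -/
def HidaTest {k : ℝ} (ν : Measure (DistS2 k)) : Type := hidaSubmodule ν

instance {k : ℝ} (ν : Measure (DistS2 k)) : AddCommGroup (HidaTest ν) :=
  inferInstanceAs (AddCommGroup (hidaSubmodule ν))

instance {k : ℝ} (ν : Measure (DistS2 k)) : Module ℝ (HidaTest ν) :=
  inferInstanceAs (Module ℝ (hidaSubmodule ν))

/-- The map `ψ ↦ Γ(A)^p ψ` from `(𝓔)` to `(L²)`. -/
def HidaTest.gammaPow {k : ℝ} (ν : Measure (DistS2 k)) (p : ℕ) : HidaTest ν →ₗ[ℝ] L2 ν :=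
  (pmapPow (secondQuant ν) p).toFun ∘ₗ Submodule.inclusion (iInf_le _ p)

/-- The norms `‖ψ‖_p = ‖Γ(A)^p ψ‖` on `(𝓔)`. -/
def HidaTest.seminorms {k : ℝ} (ν : Measure (DistS2 k)) : SeminormFamily ℝ (HidaTest ν) ℕ :=
  fun p => (normSeminorm ℝ (L2 ν)).comp (HidaTest.gammaPow ν p)

instance {k : ℝ} (ν : Measure (DistS2 k)) : TopologicalSpace (HidaTest ν) :=
  (HidaTest.seminorms ν).moduleFilterBasis.topology

lemma HidaTest.withSeminorms {k : ℝ} (ν : Measure (DistS2 k)) :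
    WithSeminorms (HidaTest.seminorms ν) := ⟨rfl⟩

instance {k : ℝ} (ν : Measure (DistS2 k)) : IsTopologicalAddGroup (HidaTest ν) :=
  (HidaTest.withSeminorms ν).topologicalAddGroup

instance {k : ℝ} (ν : Measure (DistS2 k)) : ContinuousSMul ℝ (HidaTest ν) :=
  (HidaTest.withSeminorms ν).continuousSMul

/-- The space `(𝓔')` of Hida distributions: the topological dual of `(𝓔)`, with the strong
topology. -/
abbrev HidaDist {k : ℝ} (ν : Measure (DistS2 k)) : Type := StrongDual ℝ (HidaTest ν)

/-- The canonical pairing of `(𝓔')` with `(𝓔)`. -/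
def hidaPairing {k : ℝ} (ν : Measure (DistS2 k)) : HidaDist ν →ₗ[ℝ] HidaTest ν →ₗ[ℝ] ℝ :=
  ContinuousLinearMap.coeLM ℝ

/-- The inner product of `(L²)` as a bilinear map. -/
def l2Pairing {k : ℝ} (ν : Measure (DistS2 k)) : L2 ν →ₗ[ℝ] L2 ν →ₗ[ℝ] ℝ := innerₗ (L2 ν)

/-! ### Symplectic forms -/

/-- The form `Ω((ψ₁, Ψ₁), (ψ₂, Ψ₂)) = ⟪⟪Ψ₂, ψ₁⟫⟫ - ⟪⟪Ψ₁, ψ₂⟫⟫` on `Q × P` defined by a pairing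
of `P` with `Q`. -/
def canonicalForm {Q P : Type*} [AddCommGroup Q] [Module ℝ Q] [AddCommGroup P] [Module ℝ P]
    (B : P →ₗ[ℝ] Q →ₗ[ℝ] ℝ) : (Q × P) →ₗ[ℝ] (Q × P) →ₗ[ℝ] ℝ :=
  LinearMap.mk₂ ℝ (fun v w => B w.2 v.1 - B v.2 w.1)
    (by intro v v' w; simp only [Prod.fst_add, Prod.snd_add, map_add, LinearMap.add_apply]; ring)
    (by intro c v w; simp only [Prod.smul_fst, Prod.smul_snd, map_smul, LinearMap.smul_apply]
        simp only [smul_eq_mul]; ring)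
    (by intro v w w'; simp only [Prod.fst_add, Prod.snd_add, map_add, LinearMap.add_apply]; ring)
    (by intro c v w; simp only [Prod.smul_fst, Prod.smul_snd, map_smul, LinearMap.smul_apply]
        simp only [smul_eq_mul]; ring)

section Symplectic

variable {V : Type*} [AddCommGroup V] [Module ℝ V] [TopologicalSpace V] [IsTopologicalAddGroup V]
  [ContinuousSMul ℝ V]

/-- A weakly non-degenerate symplectic form: a skew-symmetric bilinear form which is sequentially
continuous on the product, induces a continuous map into the strong dual, and has trivial
kernel. -/
structure IsWeaklySymplectic (Ω : V →ₗ[ℝ] V →ₗ[ℝ] ℝ) : Prop where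
  skew : ∀ v w, Ω v w = -Ω w v
  seqContinuous : SeqContinuous fun z : V × V => Ω z.1 z.2
  continuous_flat : ∃ flat : V →L[ℝ] StrongDual ℝ V, ∀ v w, flat v w = Ω v w
  nondegenerate : ∀ v, (∀ w, Ω v w = 0) → v = 0

/-- Strong non-degeneracy: `v ↦ Ω(v, ·)` is a topological isomorphism onto the strong dual. -/
def IsStronglyNondegenerate (Ω : V →ₗ[ℝ] V →ₗ[ℝ] ℝ) : Prop :=
  ∃ flat : V ≃L[ℝ] StrongDual ℝ V, ∀ v w, flat v w = Ω v w

end Symplectic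

end HidaPhaseSpace

end

open Filter Bornology Topology

namespace HidaPhaseSpace

/-! ### Strong duals: the bidual map and sequential continuity of evaluation. -/

section Bidual

variable {E : Type*} [AddCommGroup E] [Module ℝ E] [TopologicalSpace E] [IsTopologicalAddGroup E]
  [ContinuousSMul ℝ E]

/-! The form antisymmetrises a pairing `B` of `P` with `Q`, so by `isWeaklySymplectic_canonicalForm`
it suffices that `B` is sequentially continuous, induces continuous maps into both strong duals, and
separates points on both sides. An inner product does all this, and Riesz representation adds
surjectivity. For Hida distributions `P` is the strong dual of `Q`, so one map is the identity; the
other, into the bidual, is continuous because countably many norms make `(𝓔)` first countable.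
Strong convergence is uniform on the bounded range of a convergent sequence, hence sequential
continuity. Elements of `(L²)`, viewed as distributions, separate test functionals. -/

/-- The canonical map into the strong bidual, as a linear map. -/
def bidualLinearMap : E →ₗ[ℝ] StrongDual ℝ (StrongDual ℝ E) where
  toFun x :=
    { toFun := fun Φ => Φ x
      map_add' := fun _ _ => rfl
      map_smul' := fun _ _ => rfl
      cont := continuous_eval_const x }
  map_add' x y := by ext Φ; exact map_add Φ x y
  map_smul' c x := by ext Φ; exact map_smul Φ c x

/-- A first countable space is infrabarrelled: the canonical map into the strong bidual is
continuous. -/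
def bidualMap [FirstCountableTopology E] : E →L[ℝ] StrongDual ℝ (StrongDual ℝ E) where
  toLinearMap := bidualLinearMap
  cont := by
    -- Out of a first countable space, a linear map preserving bounded sets is continuous. Here this
    -- asks that `Φ x` stay bounded for `Φ ∈ T`, `x ∈ s`, which is strong boundedness of `T`.
    refine LinearMap.continuous_of_locally_bounded (𝕜 := ℝ) (𝕜' := ℝ) (E := E)
      (F := StrongDual ℝ (StrongDual ℝ E)) (σ := RingHom.id ℝ) bidualLinearMap fun s hs => ?_
    refine ContinuousLinearMap.isVonNBounded_iff.2 fun T hT => ?_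
    refine (ContinuousLinearMap.isVonNBounded_image2_apply hT hs).subset ?_
    rintro _ ⟨_, ⟨x, hx, rfl⟩, Φ, hΦ, rfl⟩
    exact ⟨Φ, hΦ, x, hx, rfl⟩

/-- The pairing of the strong dual with the space is sequentially continuous. -/
lemma seqContinuous_strongDual_pairing :
    SeqContinuous fun p : StrongDual ℝ E × E => p.1 p.2 := by
  intro z p hz
  have h1 : Tendsto (fun n => (z n).1) atTop (𝓝 p.1) := (continuous_fst.tendsto p).comp hz
  have h2 : Tendsto (fun n => (z n).2) atTop (𝓝 p.2) := (continuous_snd.tendsto p).comp hz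
  have h3 : Tendsto (fun n => (z n).1 - p.1) atTop (𝓝 0) := by
    simpa using h1.sub_const p.1
  -- Split `Φₙ xₙ = (Φₙ - Φ) xₙ + Φ xₙ`; the first term vanishes uniformly on the bounded set of all
  -- `xₙ`.
  have h4 : Tendsto (fun n => ((z n).1 - p.1) (z n).2) atTop (𝓝 0) := by
    rw [tendsto_def]
    intro U hU
    filter_upwards [h3.eventually
      (ContinuousLinearMap.eventually_nhds_zero_mapsTo (h2.isVonNBounded_range ℝ) hU)] with n hn
    exact hn ⟨n, rfl⟩
  have h5 : Tendsto (fun n => p.1 (z n).2) atTop (𝓝 (p.1 p.2)) :=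
    (p.1.continuous.tendsto _).comp h2
  simpa [Function.comp_def] using h4.add h5

end Bidual

/-! ### From a pairing to a symplectic form. -/

section CanonicalForm

variable {Q P : Type*} [AddCommGroup Q] [Module ℝ Q] [AddCommGroup P] [Module ℝ P]

@[simp] lemma canonicalForm_apply (B : P →ₗ[ℝ] Q →ₗ[ℝ] ℝ) (v w : Q × P) :
    canonicalForm B v w = B w.2 v.1 - B v.2 w.1 := rfl

variable [TopologicalSpace Q] [TopologicalSpace P]

/-- The canonical form of a sequentially continuous pairing which induces continuous maps into
both strong duals and separates the points of both spaces. -/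
lemma isWeaklySymplectic_canonicalForm (B : P →ₗ[ℝ] Q →ₗ[ℝ] ℝ)
    (hB : SeqContinuous fun p : P × Q => B p.1 p.2)
    (f : P →L[ℝ] StrongDual ℝ Q) (hf : ∀ p q, f p q = B p q)
    (g : Q →L[ℝ] StrongDual ℝ P) (hg : ∀ q p, g q p = B p q)
    (hP : ∀ p, (∀ q, B p q = 0) → p = 0) (hQ : ∀ q, (∀ p, B p q = 0) → q = 0) :
    IsWeaklySymplectic (canonicalForm B) where
  skew v w := by simp
  seqContinuous z p hz := by
    have h1 := hB (((by fun_prop : Continuous fun z : (Q × P) × (Q × P) =>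
      (z.2.2, z.1.1)).tendsto p).comp hz)
    have h2 := hB (((by fun_prop : Continuous fun z : (Q × P) × (Q × P) =>
      (z.1.2, z.2.1)).tendsto p).comp hz)
    exact h1.sub h2
  continuous_flat := by
    -- Transposes of the two projections carry functionals on `P` and on `Q` to functionals on `Q ×
    -- P`, continuously for the strong topologies.
    refine ⟨((ContinuousLinearMap.snd ℝ Q P).precomp ℝ) ∘L g ∘L ContinuousLinearMap.fst ℝ Q P -
      ((ContinuousLinearMap.fst ℝ Q P).precomp ℝ) ∘L f ∘L ContinuousLinearMap.snd ℝ Q P,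
      fun v w => ?_⟩
    simp [hf, hg]
  nondegenerate v hv := by
    refine Prod.ext (hQ _ fun p => ?_) (hP _ fun q => ?_)
    · simpa using hv (0, p)
    · simpa using hv (q, 0)

end CanonicalForm

/-! ### The inner product case. -/

section Hilbert

variable {H : Type*} [NormedAddCommGroup H] [InnerProductSpace ℝ H]

lemma isWeaklySymplectic_canonicalForm_inner :
    IsWeaklySymplectic (canonicalForm (innerₗ H)) := by
  refine isWeaklySymplectic_canonicalForm _ (continuous_inner (𝕜 := ℝ)).seqContinuous (innerSL ℝ)
    (fun _ _ => rfl) (innerSL ℝ) (fun q p => real_inner_comm p q) (fun p hp => ?_) fun q hq => ?_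
  · exact inner_self_eq_zero.1 (hp p)
  · exact inner_self_eq_zero.1 (hq q)

/-- The Riesz representation theorem makes the canonical form of a Hilbert space strongly
non-degenerate. -/
lemma isStronglyNondegenerate_canonicalForm_inner [CompleteSpace H] :
    IsStronglyNondegenerate (canonicalForm (innerₗ H)) := by
  obtain ⟨flat, hflat⟩ := (isWeaklySymplectic_canonicalForm_inner (H := H)).continuous_flat
  have hinj : LinearMap.ker flat.toLinearMap = ⊥ := by
    refine LinearMap.ker_eq_bot'.2 fun v hv => ?_
    refine isWeaklySymplectic_canonicalForm_inner.nondegenerate v fun w => ?_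
    rw [← hflat]
    exact DFunLike.congr_fun hv w
  have hsurj : LinearMap.range flat.toLinearMap = ⊤ := by
    refine LinearMap.range_eq_top.2 fun φ => ?_
    -- Since `Ω((a, -b), (c, d)) = ⟪d, a⟫ + ⟪b, c⟫`, the vectors `a` and `b` must represent `φ` on
    -- the second and first factors.
    let a := (toDual ℝ H).symm (φ ∘L ContinuousLinearMap.inr ℝ H H)
    let b := (toDual ℝ H).symm (φ ∘L ContinuousLinearMap.inl ℝ H H)
    have ha (d : H) : inner ℝ a d = φ (0, d) := toDual_symm_apply
    have hb (c : H) : inner ℝ b c = φ (c, 0) := toDual_symm_apply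
    refine ⟨(a, -b), ContinuousLinearMap.ext fun w => ?_⟩
    change flat (a, -b) w = φ w
    rw [hflat, canonicalForm_apply, innerₗ_apply_apply, innerₗ_apply_apply, real_inner_comm,
      ha, inner_neg_left, hb, sub_neg_eq_add, ← map_add]
    simp
  -- The inverse is continuous by the open mapping theorem.
  let e : (H × H) ≃L[ℝ] StrongDual ℝ (H × H) :=
    ContinuousLinearEquiv.ofBijective (𝕜 := ℝ) (𝕜' := ℝ) (σ := RingHom.id ℝ)
      (σ' := RingHom.id ℝ) (E := H × H) (F := StrongDual ℝ (H × H)) flat hinj hsurj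
  exact ⟨e, hflat⟩

end Hilbert

/-! ### Hida test functionals and distributions. -/

section Hida

variable {k : ℝ} (ν : Measure (DistS2 k))

instance : FirstCountableTopology (HidaTest ν) :=
  (HidaTest.withSeminorms ν).firstCountableTopology

/-- The continuous inclusion of the Hida test functionals into `(L²)`. -/
noncomputable def HidaTest.toL2 : HidaTest ν →L[ℝ] L2 ν where
  toLinearMap := HidaTest.gammaPow ν 0
  cont := by
    -- The `(L²)` norm is exactly the seminorm of index `0`, so the constant is `1`.
    refine WithSeminorms.continuous_of_isBounded (HidaTest.withSeminorms ν)
      (norm_withSeminorms ℝ (L2 ν)) _ fun _ => ⟨{0}, 1, fun ψ => ?_⟩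
    simp [HidaTest.seminorms]

/-- `pmapPow` at `0` is the identity, so the map unfolds to the coercion from `hidaSubmodule ν`. -/
lemma HidaTest.toL2_injective : Function.Injective (HidaTest.toL2 ν) :=
  fun _ _ h => Subtype.ext h

/-- The Hida distributions separate the Hida test functionals. -/
lemma HidaTest.eq_zero_of_forall_dual_eq_zero (ψ : HidaTest ν) (h : ∀ Φ : HidaDist ν, Φ ψ = 0) :
    ψ = 0 := by
  apply HidaTest.toL2_injective ν
  rw [map_zero]
  -- The distribution `⟪ψ, ·⟫` takes the value `‖ψ‖²` at `ψ`.
  exact inner_self_eq_zero.1 (h (innerSL ℝ (HidaTest.toL2 ν ψ) ∘L HidaTest.toL2 ν))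

lemma isWeaklySymplectic_canonicalForm_hidaPairing :
    IsWeaklySymplectic (canonicalForm (hidaPairing ν)) :=
  isWeaklySymplectic_canonicalForm _ seqContinuous_strongDual_pairing
    (ContinuousLinearMap.id ℝ (HidaDist ν)) (fun _ _ => rfl) bidualMap (fun _ _ => rfl)
    (fun _ h => ContinuousLinearMap.ext h) (HidaTest.eq_zero_of_forall_dual_eq_zero ν)

end Hida

end HidaPhaseSpace

open HidaPhaseSpace MeasureTheory in
theorem mainTheorem8 (k : ℝ) (hk : 1 < k) (ν : Measure (DistS2 k)) (hν : IsWhiteNoise ν) :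
    (Continuous (fun z : (L2 ν × L2 ν) × (L2 ν × L2 ν) =>
        canonicalForm (l2Pairing ν) z.1 z.2) ∧
      IsWeaklySymplectic (canonicalForm (l2Pairing ν)) ∧
      IsStronglyNondegenerate (canonicalForm (l2Pairing ν))) ∧
    IsWeaklySymplectic (canonicalForm (hidaPairing ν)) := by
  refine ⟨⟨?_, isWeaklySymplectic_canonicalForm_inner, isStronglyNondegenerate_canonicalForm_inner⟩,
    isWeaklySymplectic_canonicalForm_hidaPairing ν⟩
  change Continuous fun z : (L2 ν × L2 ν) × (L2 ν × L2 ν) =>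
    inner ℝ z.2.2 z.1.1 - inner ℝ z.1.2 z.2.1
  fun_prop
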